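/- Conventions. For a subset $A$ of a metric space $X$ and $D\ge 0$ let $N_D(A)=\{x\in X: d(x,a)\le D \text{ for some } a\in A\}$, and for $A,B\subseteq X$ let $d(A,B)=\inf\{d(a,b):a\in A,\ b\in B\}$ (equal to $+\infty$ if $A$ or $B$ is empty). A $(k,c)$-quasigeodesic joining $x$ to $y$ is a map $\gamma:[a,b]\to X$, not necessarily continuous, with $\gamma(a)=x$, $\gamma(b)=y$ and $|s-t|/k-c\le d(\gamma(s),\gamma(t))\le k|s-t|+c$ for all $s,t\in[a,b]$; a geodesic is a $(1,0)$-quasigeodesic. A metric space is called $\delta$-hyperbolic if either it is a geodesic space all of whose geodesic triangles are $\delta$-slim (each side lies in the $N_\delta$-neighborhood of the union of the other two sides), or it is a length space which is not geodesic and satisfies $(x.y)_p\ge\min\{(x.z)_p,(y.z)_p\}-\delta$ for all points $p,x,y,z$, where $(x.y)_p=\frac12\big(d(p,x)+d(p,y)-d(x,y)\big)$. A subset $A$ of a $\delta$-hyperbolic space $X$ is called $K$-quasiconvex if $N_K(A)$ contains every geodesic with end points in $A$ (when $X$ is geodesic), respectively every $(1,1)$-quasigeodesic with end points in $A$ (when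 $X$ is a length space that is not geodesic). An $\epsilon$-approximate nearest point projection map onto $U\subseteq X$ is a map $P:X\to U$ such that $P(u)=u$ for all $u\in U$, and $d(x,P(x))\le d(x,z)+\epsilon$ for all $x\in X\setminus U$ and all $z\in U$. A map $f$ is coarsely $L$-Lipschitz if $d(f(x),f(y))\le L\,d(x,y)+L$ for all $x,y$. Theorem. Given $\delta\ge 0$, $K\ge 0$, $\epsilon\ge 0$ there are constants $L,D,R\ge 0$, depending only on $\delta,K,\epsilon$, such that for every $\delta$-hyperbolic metric space $X$, every $K$-quasiconvex subset $U\subseteq X$ and every $\epsilon$-approximate nearest point projection map $P:X\to U$ the following hold. (1) $P$ is coarsely $L$-Lipschitz. (2) Let $V\subseteq X$ be another $K$-quasiconvex subset. If $v_1,v_2\in V$ and $u_i=P(v_i)$ for $i=1,2$ satisfy $d(u_1,u_2)\ge D$, then $u_1,u_2\in N_R(V)$. In particular, if the diameter of $P(V)$ is at least $D$, then $d(U,V)\le R$. -/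

import Mathlib

namespace CoarseGeom

open Set

/-- The closed `D`-neighborhood `N_D(A) = {x | d(x,a) ≤ D for some a ∈ A}`. -/
def nbhd {X : Type*} [MetricSpace X] (D : ℝ) (A : Set X) : Set X :=
  {x | ∃ a ∈ A, dist x a ≤ D}

/-- The distance `d(A,B) = inf {d(x,B) : x ∈ A}` of two subsets, as an extended nonnegative
number (it is `⊤` if one of the sets is empty). -/
noncomputable def setDist {X : Type*} [MetricSpace X] (A B : Set X) : ENNReal :=
  ⨅ x ∈ A, Metric.infEDist x B

/-- A coarsely `(c, c')`-Lipschitz map; no continuity is required. -/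
def IsCoarselyLipschitz {X Y : Type*} [MetricSpace X] [MetricSpace Y] (c c' : ℝ)
    (f : X → Y) : Prop :=
  ∀ x₁ x₂ : X, dist (f x₁) (f x₂) ≤ c * dist x₁ x₂ + c'

/-- `S` is the image of a `(k, ε)`-quasigeodesic `γ : [a, b] → X` joining `x` to `y`, i.e. of a
(not necessarily continuous) `(k, ε)`-quasi-isometric embedding of `[a, b]` with `γ a = x` and
`γ b = y`. Only the values of `γ` on `[a, b]` matter. -/
def IsQuasiGeodesicSegment {X : Type*} [MetricSpace X] (k ε : ℝ) (S : Set X) (x y : X) : Prop :=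
  ∃ (a b : ℝ) (γ : ℝ → X), a ≤ b ∧
    (∀ s ∈ Icc a b, ∀ t ∈ Icc a b,
      dist s t / k - ε ≤ dist (γ s) (γ t) ∧ dist (γ s) (γ t) ≤ k * dist s t + ε) ∧
    γ a = x ∧ γ b = y ∧ S = γ '' Icc a b

/-- `S` is (the image of) a geodesic joining `x` to `y`: a `(1, 0)`-quasigeodesic. -/
def IsGeodesicSegment {X : Type*} [MetricSpace X] (S : Set X) (x y : X) : Prop :=
  IsQuasiGeodesicSegment 1 0 S x y

/-- Any two points are joined by a geodesic. -/
def IsGeodesicSpace (X : Type*) [MetricSpace X] : Prop :=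
  ∀ x y : X, ∃ S : Set X, IsGeodesicSegment S x y

/-- Length space: the distance of any two points is the infimum of the lengths of the paths
joining them (a path that is not rectifiable has length `⊤`). -/
def IsLengthSpace (X : Type*) [MetricSpace X] : Prop :=
  ∀ x y : X, edist x y = ⨅ γ : Path x y, eVariationOn γ univ

/-- `δ`-hyperbolicity in the sense of Rips: all geodesic triangles are `δ`-slim. -/
def RipsHyperbolic (δ : ℝ) (X : Type*) [MetricSpace X] : Prop :=
  ∀ (x y z : X) (S₁ S₂ S₃ : Set X),
    IsGeodesicSegment S₁ x y → IsGeodesicSegment S₂ y z → IsGeodesicSegment S₃ z x →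
      S₁ ⊆ nbhd δ (S₂ ∪ S₃) ∧ S₂ ⊆ nbhd δ (S₃ ∪ S₁) ∧ S₃ ⊆ nbhd δ (S₁ ∪ S₂)

/-- The Gromov inner product `(x.y)_p`. -/
noncomputable def gromovProduct {X : Type*} [MetricSpace X] (p x y : X) : ℝ :=
  (dist p x + dist p y - dist x y) / 2

/-- `δ`-hyperbolicity in the sense of Gromov, with respect to every base point. -/
def GromovHyperbolic (δ : ℝ) (X : Type*) [MetricSpace X] : Prop :=
  ∀ p x y z : X,
    min (gromovProduct p x z) (gromovProduct p y z) - δ ≤ gromovProduct p x y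

/-- A `δ`-hyperbolic space: either a geodesic space that is `δ`-hyperbolic in the sense of Rips,
or a length space that is not geodesic and is `δ`-hyperbolic in the sense of Gromov. -/
def IsHyperbolicSpace (δ : ℝ) (X : Type*) [MetricSpace X] : Prop :=
  (IsGeodesicSpace X ∧ RipsHyperbolic δ X) ∨
    (IsLengthSpace X ∧ ¬ IsGeodesicSpace X ∧ GromovHyperbolic δ X)

/-- `K`-quasiconvexity: in a geodesic space all geodesics with end points in `A`, and in a
length space that is not geodesic all `(1, 1)`-quasigeodesics with end points in `A`, are
contained in `N_K(A)`. -/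
def IsQuasiconvex {X : Type*} [MetricSpace X] (K : ℝ) (A : Set X) : Prop :=
  (IsGeodesicSpace X →
    ∀ x ∈ A, ∀ y ∈ A, ∀ S : Set X, IsGeodesicSegment S x y → S ⊆ nbhd K A) ∧
  (¬ IsGeodesicSpace X →
    ∀ x ∈ A, ∀ y ∈ A, ∀ S : Set X, IsQuasiGeodesicSegment 1 1 S x y → S ⊆ nbhd K A)

/-- `y` is an `ε`-approximate nearest point projection of `x` on `A`. -/
def IsApproxNearestPoint {X : Type*} [MetricSpace X] (ε : ℝ) (A : Set X) (x y : X) : Prop :=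
  y ∈ A ∧ ∀ z ∈ A, dist x y ≤ dist x z + ε

/-- An `ε`-approximate nearest point projection map `X → A`. -/
def IsApproxProjection {X : Type*} [MetricSpace X] (ε : ℝ) (A : Set X) (f : X → A) : Prop :=
  (∀ a : A, f a = a) ∧ ∀ x ∉ A, IsApproxNearestPoint ε A x (f x)

end CoarseGeom

namespace CoarseGeom

open Set

/-! Both kinds of hyperbolic space satisfy the four-point inequality
(`IsHyperbolicSpace.gromovHyperbolic`), and quasiconvex sets contain coarsely intermediate points
(`IsQuasiconvex.isCoarselyConvex`); nothing else about geodesics is used. If `u` is a near-nearest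
point of `U` to `v`, going from `v` to any point of `U` through `u` is coarsely shortest. Hence two
projections `u₁`, `u₂` are either close or lie coarsely on the way from `v₁` to `v₂`
(`IsApproxNearestPoint.dist_le_or`). This gives the Lipschitz bound, and in the second case coarse
convexity of `V` places `u₁` and `u₂` near `V`. -/

/-- `A` is coarsely metrically convex: any two of its points are joined by coarsely intermediate
points of `A`. -/
def IsCoarselyConvex {X : Type*} [MetricSpace X] (C : ℝ) (A : Set X) : Prop :=
  ∀ x ∈ A, ∀ y ∈ A, ∀ t : ℝ, 0 ≤ t → t ≤ dist x y →
    ∃ q ∈ A, dist x q ≤ t + C ∧ dist q y ≤ dist x y - t + C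

/-! ### Geodesics and quasigeodesics -/

section Segments

variable {X : Type*} [MetricSpace X]

theorem IsGeodesicSegment.dist_eq {S : Set X} {x y : X} (h : IsGeodesicSegment S x y) :
    ∃ (a b : ℝ) (γ : ℝ → X), a ≤ b ∧
      (∀ s ∈ Icc a b, ∀ t ∈ Icc a b, dist (γ s) (γ t) = |s - t|) ∧
      γ a = x ∧ γ b = y ∧ S = γ '' Icc a b := by
  obtain ⟨a, b, γ, hab, hγ, hx, hy, hS⟩ := h
  refine ⟨a, b, γ, hab, fun s hs t ht => ?_, hx, hy, hS⟩
  obtain ⟨h1, h2⟩ := hγ s hs t ht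
  rw [Real.dist_eq] at h1 h2
  linarith

theorem IsGeodesicSegment.dist_add {S : Set X} {x y q : X} (h : IsGeodesicSegment S x y)
    (hq : q ∈ S) : dist x q + dist q y = dist x y := by
  obtain ⟨a, b, γ, hab, hγ, rfl, rfl, rfl⟩ := h.dist_eq
  obtain ⟨t, ht, rfl⟩ := hq
  have ha := left_mem_Icc.2 hab
  have hb := right_mem_Icc.2 hab
  rw [hγ a ha t ht, hγ t ht b hb, hγ a ha b hb, abs_of_nonpos (by linarith [ht.1]),
    abs_of_nonpos (by linarith [ht.2]), abs_of_nonpos (by linarith)]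
  ring

theorem IsGeodesicSegment.right_mem {S : Set X} {x y : X} (h : IsGeodesicSegment S x y) :
    y ∈ S := by
  obtain ⟨a, b, γ, hab, -, -, rfl, rfl⟩ := h
  exact ⟨b, right_mem_Icc.2 hab, rfl⟩

theorem IsGeodesicSegment.left_mem {S : Set X} {x y : X} (h : IsGeodesicSegment S x y) :
    x ∈ S := by
  obtain ⟨a, b, γ, hab, -, rfl, -, rfl⟩ := h
  exact ⟨a, left_mem_Icc.2 hab, rfl⟩

/-- A quasigeodesic segment contained in a neighbourhood of `A` provides coarsely intermediate
points of `A`. -/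
theorem IsQuasiGeodesicSegment.exists_between {c K : ℝ} (hc : 0 ≤ c) {S A : Set X} {x y : X}
    (h : IsQuasiGeodesicSegment 1 c S x y) (hS : S ⊆ nbhd K A) {t : ℝ} (ht0 : 0 ≤ t)
    (ht : t ≤ dist x y) :
    ∃ q ∈ A, dist x q ≤ t + (K + 2 * c) ∧ dist q y ≤ dist x y - t + (K + 2 * c) := by
  obtain ⟨a, b, γ, hab, hγ, rfl, rfl, rfl⟩ := h
  have ha := left_mem_Icc.2 hab
  have hb := right_mem_Icc.2 hab
  -- The domain can be shorter than `dist x y` by up to `c`, so `t` is truncated.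
  have hs : a + min t (b - a) ∈ Icc a b := by
    have h1 : 0 ≤ min t (b - a) := le_min ht0 (by linarith)
    have h2 := min_le_right t (b - a)
    constructor <;> linarith
  obtain ⟨q, hqA, hq⟩ := hS ⟨_, hs, rfl⟩
  have h1 := (hγ a ha _ hs).2
  have h2 := (hγ _ hs b hb).2
  have h3 := (hγ a ha b hb).1
  rw [Real.dist_eq, abs_of_nonpos (by linarith [hs.1])] at h1
  rw [Real.dist_eq, abs_of_nonpos (by linarith [hs.2])] at h2
  rw [Real.dist_eq, abs_of_nonpos (by linarith)] at h3
  have h4 := dist_triangle (γ a) (γ (a + min t (b - a))) q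
  have h5 := dist_triangle q (γ (a + min t (b - a))) (γ b)
  rw [dist_comm q (γ (a + _))] at h5
  refine ⟨q, hqA, ?_, ?_⟩
  · have := min_le_left t (b - a)
    linarith
  · rcases min_choice t (b - a) with h | h <;> rw [h] at h2 h5 hq <;> linarith

theorem dist_add_dist_add_dist_le_variation {x y : X} (p : Path x y) {r s : unitInterval}
    (hrs : r ≤ s) :
    edist x (p r) + edist (p r) (p s) + edist (p s) y ≤ eVariationOn p univ := by
  have h1 : edist x (p r) ≤ eVariationOn p (univ ∩ Icc 0 r) := by
    simpa using eVariationOn.edist_le p (s := univ ∩ Icc 0 r) (x := 0) (y := r)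
      ⟨trivial, left_mem_Icc.2 r.2.1⟩ ⟨trivial, right_mem_Icc.2 r.2.1⟩
  have h2 : edist (p r) (p s) ≤ eVariationOn p (univ ∩ Icc r s) :=
    eVariationOn.edist_le p ⟨trivial, left_mem_Icc.2 hrs⟩ ⟨trivial, right_mem_Icc.2 hrs⟩
  have h3 : edist (p s) y ≤ eVariationOn p (univ ∩ Icc s 1) := by
    simpa using eVariationOn.edist_le p (s := univ ∩ Icc s 1) (x := s) (y := 1)
      ⟨trivial, left_mem_Icc.2 s.2.2⟩ ⟨trivial, right_mem_Icc.2 s.2.2⟩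
  calc _ ≤ _ := add_le_add (add_le_add h1 h2) h3
    _ = eVariationOn p (univ ∩ Icc 0 1) := by
        rw [eVariationOn.Icc_add_Icc p r.2.1 hrs (mem_univ r),
          eVariationOn.Icc_add_Icc p s.2.1 s.2.2 (mem_univ s)]
    _ ≤ _ := eVariationOn.mono p inter_subset_left

/-- In a length space any two points are joined by a `(1, c)`-quasigeodesic, for every `c > 0`:
choose on an almost shortest path a point at each distance from the starting point. -/
theorem IsLengthSpace.exists_quasiGeodesicSegment (hX : IsLengthSpace X) {c : ℝ} (hc : 0 < c)
    (x y : X) : ∃ S, IsQuasiGeodesicSegment 1 c S x y := by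
  have hlt : (⨅ γ : Path x y, eVariationOn γ univ) < ENNReal.ofReal (dist x y + c) := by
    rw [← hX x y, edist_dist]
    exact (ENNReal.ofReal_lt_ofReal_iff (by positivity)).2 (by linarith)
  obtain ⟨p, hp⟩ := iInf_lt_iff.1 hlt
  have key : ∀ r s : unitInterval, r ≤ s →
      dist x (p r) + dist (p r) (p s) + dist (p s) y ≤ dist x y + c := by
    intro r s hrs
    have h := (dist_add_dist_add_dist_le_variation p hrs).trans hp.le
    rw [edist_dist, edist_dist, edist_dist, ← ENNReal.ofReal_add dist_nonneg dist_nonneg,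
      ← ENNReal.ofReal_add (by positivity) dist_nonneg,
      ENNReal.ofReal_le_ofReal_iff (by positivity)] at h
    exact h
  -- The second clause makes the quasigeodesic end at `y`, since other points of the path may also
  -- be at distance `dist x y` from `x`.
  have hτ : ∀ t ∈ Icc 0 (dist x y), ∃ r : unitInterval, dist x (p r) = t ∧
      (t = dist x y → p r = y) := by
    intro t ht
    rcases eq_or_ne t (dist x y) with rfl | hne
    · exact ⟨1, by simp, by simp⟩
    · have hcont : Continuous fun r => dist x (p r) := by fun_prop
      have ht' : t ∈ Icc (dist x (p 0)) (dist x (p 1)) := by simpa using ht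
      obtain ⟨r, hr⟩ := mem_range_of_exists_le_of_exists_ge hcont ⟨0, ht'.1⟩ ⟨1, ht'.2⟩
      exact ⟨r, hr, fun h => absurd h hne⟩
  choose! τ hτd hτe using hτ
  have upper : ∀ s ∈ Icc 0 (dist x y), ∀ t ∈ Icc 0 (dist x y), s ≤ t →
      dist (p (τ s)) (p (τ t)) ≤ t - s + c := by
    intro s hs t ht hst
    have h1 := dist_triangle x (p (τ s)) y
    have h2 := dist_triangle x (p (τ t)) y
    rw [hτd s hs] at h1
    rw [hτd t ht] at h2
    -- `τ` need not be monotone; near-minimality of the path handles either order.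
    rcases le_total (τ s) (τ t) with h | h
    · have h3 := key _ _ h
      rw [hτd s hs] at h3
      linarith
    · have h3 := key _ _ h
      rw [hτd t ht, dist_comm (p (τ t))] at h3
      linarith
  refine ⟨_, 0, dist x y, fun t => p (τ t), dist_nonneg, fun s hs t ht => ⟨?_, ?_⟩, ?_, ?_, rfl⟩
  · have h := abs_dist_sub_le (p (τ s)) (p (τ t)) x
    rw [dist_comm _ x, dist_comm _ x, hτd s hs, hτd t ht] at h
    rw [Real.dist_eq]
    linarith
  · rw [Real.dist_eq]
    rcases le_total s t with h | h
    · rw [abs_of_nonpos (by linarith)]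
      linarith [upper s hs t ht h]
    · rw [abs_of_nonneg (by linarith), dist_comm]
      linarith [upper t ht s hs h]
  · have h := hτd 0 (left_mem_Icc.2 dist_nonneg)
    exact (dist_eq_zero.1 h).symm
  · exact hτe _ (right_mem_Icc.2 dist_nonneg) rfl

end Segments

/-! ### From slim triangles to the four-point inequality -/

section Hyperbolicity

variable {X : Type*} [MetricSpace X]

theorem GromovHyperbolic.mono {δ δ' : ℝ} (h : GromovHyperbolic δ X) (hδ : δ ≤ δ') :
    GromovHyperbolic δ' X := fun p x y z => by linarith [h p x y z]

/-- The four point form of Gromov hyperbolicity. -/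
theorem GromovHyperbolic.dist_add_dist_le {δ : ℝ} (h : GromovHyperbolic δ X) (p x y z : X) :
    dist x y + dist p z ≤ max (dist x z + dist p y) (dist y z + dist p x) + 2 * δ := by
  have h1 := h p x y z
  simp only [gromovProduct] at h1
  rcases min_choice ((dist p x + dist p z - dist x z) / 2)
    ((dist p y + dist p z - dist y z) / 2) with h2 | h2 <;> rw [h2] at h1
  · linarith [le_max_left (dist x z + dist p y) (dist y z + dist p x)]
  · linarith [le_max_right (dist x z + dist p y) (dist y z + dist p x)]

theorem gromovProduct_le_dist {S : Set X} {x y q : X} (h : IsGeodesicSegment S x y) (hq : q ∈ S)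
    (p : X) : gromovProduct p x y ≤ dist p q := by
  have h1 := h.dist_add hq
  have h2 := dist_triangle p q x
  have h3 := dist_triangle p q y
  rw [dist_comm q x] at h2
  rw [gromovProduct]
  linarith

theorem gromovProduct_comm (p x y : X) : gromovProduct p x y = gromovProduct p y x := by
  rw [gromovProduct, gromovProduct, dist_comm x y, add_comm (dist p x)]

/-- In a slim triangle, some point of a side is at distance about the Gromov product from the
opposite vertex. -/
theorem RipsHyperbolic.exists_dist_le_gromovProduct {δ : ℝ} (hδ : 0 ≤ δ)
    (h : RipsHyperbolic δ X) {p x y : X} {S₁ S₂ S₃ : Set X} (h₁ : IsGeodesicSegment S₁ x y)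
    (h₂ : IsGeodesicSegment S₂ y p) (h₃ : IsGeodesicSegment S₃ p x) :
    ∃ q ∈ S₁, dist p q ≤ gromovProduct p x y + (2 * δ + 1) := by
  have hslim := (h x y p S₁ S₂ S₃ h₁ h₂ h₃).1
  obtain ⟨a, b, γ, hab, hγ, hx, hy, hS⟩ := h₁.dist_eq
  let T : Set ℝ := {t | t ∈ Icc a b ∧ γ t ∈ nbhd δ S₃}
  have haT : a ∈ T := ⟨left_mem_Icc.2 hab, x, h₃.right_mem, by rw [hx, dist_self]; exact hδ⟩
  have hbdd : BddAbove T := ⟨b, fun t ht => ht.1.2⟩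
  -- Within 1 of the last parameter close to `S₃`: one unit further the geodesic has ended or is
  -- close to `S₂`.
  obtain ⟨t, htT, ht⟩ := exists_lt_of_lt_csSup ⟨a, haT⟩ (show sSup T - 1 < sSup T by linarith)
  have hnear : ∃ r ∈ S₂, dist (γ t) r ≤ δ + 1 := by
    by_cases hb : b ≤ t + 1
    · refine ⟨y, h₂.left_mem, ?_⟩
      rw [← hy, hγ t htT.1 b (right_mem_Icc.2 hab), abs_of_nonpos (by linarith [htT.1.2])]
      linarith
    · have ht1 : t + 1 ∈ Icc a b := ⟨by linarith [htT.1.1], by linarith⟩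
      obtain ⟨r, hr, hd⟩ := hslim (hS ▸ ⟨t + 1, ht1, rfl⟩ : γ (t + 1) ∈ S₁)
      rcases hr with hr | hr
      · refine ⟨r, hr, ?_⟩
        have h1 := dist_triangle (γ t) (γ (t + 1)) r
        rw [hγ t htT.1 _ ht1, show t - (t + 1) = -1 by ring, abs_neg, abs_one] at h1
        linarith
      · have := le_csSup hbdd (show t + 1 ∈ T from ⟨ht1, r, hr, hd⟩)
        linarith
  obtain ⟨r, hr, hrd⟩ := hnear
  obtain ⟨s, hs, hsd⟩ := htT.2
  have hq : γ t ∈ S₁ := hS ▸ ⟨t, htT.1, rfl⟩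
  refine ⟨γ t, hq, ?_⟩
  have e1 := h₁.dist_add hq
  have e2 := h₂.dist_add hr
  have e3 := h₃.dist_add hs
  have i1 := dist_triangle p s (γ t)
  have i2 := dist_triangle x s (γ t)
  have i3 := dist_triangle p r (γ t)
  have i4 := dist_triangle y r (γ t)
  rw [dist_comm (γ t) s] at hsd
  rw [dist_comm (γ t) r] at hrd
  rw [dist_comm x s] at i2
  rw [dist_comm p r] at i3
  rw [dist_comm (γ t) y] at e1
  rw [dist_comm y p] at e2
  rw [gromovProduct]
  linarith

/-- A point of side `xy` nearly realizing the product at `p` is `δ`-close to another side, whose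
distance from `p` is at least its own Gromov product. -/
theorem RipsHyperbolic.gromovHyperbolic {δ : ℝ} (hδ : 0 ≤ δ) (hX : IsGeodesicSpace X)
    (h : RipsHyperbolic δ X) : GromovHyperbolic (3 * δ + 1) X := by
  intro p x y z
  obtain ⟨S₁, h₁⟩ := hX x y
  obtain ⟨S₂, h₂⟩ := hX y p
  obtain ⟨S₃, h₃⟩ := hX p x
  obtain ⟨S₄, h₄⟩ := hX y z
  obtain ⟨S₅, h₅⟩ := hX z x
  obtain ⟨q, hq, hqd⟩ := h.exists_dist_le_gromovProduct hδ h₁ h₂ h₃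
  obtain ⟨r, hr, hrd⟩ := (h x y z S₁ S₄ S₅ h₁ h₄ h₅).1 hq
  have h6 := dist_triangle p q r
  rcases hr with hr | hr
  · have := gromovProduct_le_dist h₄ hr p
    linarith [min_le_right (gromovProduct p x z) (gromovProduct p y z)]
  · have := gromovProduct_le_dist h₅ hr p
    rw [gromovProduct_comm] at this
    linarith [min_le_left (gromovProduct p x z) (gromovProduct p y z)]

theorem IsHyperbolicSpace.gromovHyperbolic {δ : ℝ} (hδ : 0 ≤ δ) (h : IsHyperbolicSpace δ X) :
    GromovHyperbolic (3 * δ + 1) X := by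
  rcases h with ⟨hX, h⟩ | ⟨-, -, h⟩
  · exact h.gromovHyperbolic hδ hX
  · exact h.mono (by linarith)

theorem IsQuasiconvex.isCoarselyConvex {δ K : ℝ} (hX : IsHyperbolicSpace δ X)
    {A : Set X} (hA : IsQuasiconvex K A) : IsCoarselyConvex (K + 2) A := by
  intro x hx y hy t ht0 ht
  rcases hX with ⟨hg, -⟩ | ⟨hl, hg, -⟩
  · obtain ⟨S, hS⟩ := hg x y
    obtain ⟨q, hq, h1, h2⟩ := hS.exists_between le_rfl (hA.1 hg x hx y hy S hS) ht0 ht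
    exact ⟨q, hq, by linarith, by linarith⟩
  · obtain ⟨S, hS⟩ := hl.exists_quasiGeodesicSegment one_pos x y
    obtain ⟨q, hq, h1, h2⟩ := hS.exists_between zero_le_one (hA.2 hg x hx y hy S hS) ht0 ht
    exact ⟨q, hq, by linarith, by linarith⟩

end Hyperbolicity

/-! ### Approximate projections to coarsely convex sets -/

section Projection

variable {X : Type*} [MetricSpace X]

theorem IsApproxProjection.isApproxNearestPoint {ε : ℝ} (hε : 0 ≤ ε) {U : Set X} {P : X → U}
    (hP : IsApproxProjection ε U P) (x : X) : IsApproxNearestPoint ε U x (P x) := by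
  by_cases hx : x ∈ U
  · refine ⟨(P x).2, fun z _ => ?_⟩
    rw [hP.1 ⟨x, hx⟩, dist_self]
    positivity
  · exact hP.2 x hx

/-- The concatenation of a shortest segment from `v` to a coarsely convex set `U` with a segment
in `U` is coarsely geodesic. -/
theorem IsApproxNearestPoint.dist_add_dist_le {δ C ε : ℝ} (hX : GromovHyperbolic δ X)
    {U : Set X} (hU : IsCoarselyConvex C U) {v u w : X} (hu : IsApproxNearestPoint ε U v u)
    (hw : w ∈ U) : dist v u + dist u w ≤ dist v w + 2 * (C + 2 * δ + ε) := by
  -- The parameter is the Gromov product of `v` and `w` at `u`, which balances the two terms of the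
  -- maximum below; near-minimality of `u` against `q` then bounds it.
  obtain ⟨q, hq, h1, h2⟩ := hU u hu.1 w hw ((dist v u + dist u w - dist v w) / 2)
    (by linarith [dist_triangle v u w])
    (by linarith [dist_triangle v w u, dist_comm u w])
  have h3 := hu.2 q hq
  have h4 := hX.dist_add_dist_le u v q w
  rw [dist_comm u v] at h4
  rcases max_choice (dist v w + dist u q) (dist q w + dist v u) with h | h <;> rw [h] at h4 <;>
    linarith

/-- If the approximate projections of `v₁`, `v₂` are not close to each other, then the path from
`v₁` to `v₂` through the projections is coarsely geodesic. -/
theorem IsApproxNearestPoint.dist_le_or {δ C ε : ℝ} (hX : GromovHyperbolic δ X)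
    {U : Set X} (hU : IsCoarselyConvex C U) {v₁ v₂ u₁ u₂ : X}
    (h₁ : IsApproxNearestPoint ε U v₁ u₁) (h₂ : IsApproxNearestPoint ε U v₂ u₂) :
    dist u₁ u₂ ≤ 2 * (C + 2 * δ + ε) + δ ∨
      dist v₁ u₁ + dist u₁ u₂ + dist v₂ u₂ ≤
        dist v₁ v₂ + 4 * (C + 2 * δ + ε) + 2 * δ := by
  have i1 := h₁.dist_add_dist_le hX hU h₂.1
  have i2 := h₂.dist_add_dist_le hX hU h₁.1
  -- The left side is the sum of the diagonals, bounded below by `i1` and `i2`; the two terms of the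
  -- maximum give the two alternatives.
  have i3 := hX.dist_add_dist_le v₂ v₁ u₂ u₁
  rw [dist_comm u₂ u₁] at i2 i3
  rw [dist_comm v₂ v₁] at i3
  rcases max_choice (dist v₁ u₁ + dist v₂ u₂) (dist u₁ u₂ + dist v₁ v₂) with h | h <;>
    rw [h] at i3
  · left; linarith
  · right; linarith

/-- A point that lies coarsely between two points of a coarsely convex set is close to the set. -/
theorem IsCoarselyConvex.mem_nbhd {δ C M : ℝ} (hM : 0 ≤ M)
    (hX : GromovHyperbolic δ X) {V : Set X} (hV : IsCoarselyConvex C V) {v₁ v₂ u : X}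
    (h₁ : v₁ ∈ V) (h₂ : v₂ ∈ V) (hu : dist v₁ u + dist u v₂ ≤ dist v₁ v₂ + M) :
    u ∈ nbhd (M + C + 2 * δ) V := by
  -- `u` may be farther from `v₁` than `v₂` is, hence the minimum.
  obtain ⟨q, hq, i1, i2⟩ := hV v₁ h₁ v₂ h₂ (min (dist v₁ u) (dist v₁ v₂))
    (le_min dist_nonneg dist_nonneg) (min_le_right _ _)
  have h3 := hX.dist_add_dist_le u v₁ v₂ q
  rw [dist_comm v₂ q, dist_comm u v₁] at h3
  have h4 : dist u v₂ ≥ 0 := dist_nonneg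
  refine ⟨q, hq, ?_⟩
  rcases min_choice (dist v₁ u) (dist v₁ v₂) with h | h <;>
    rcases max_choice (dist v₁ q + dist u v₂) (dist q v₂ + dist v₁ u) with h' | h' <;>
    rw [h'] at h3 <;> rw [h] at i1 i2 <;>
    linarith [min_le_left (dist v₁ u) (dist v₁ v₂)]

theorem setDist_le_of_mem_nbhd {R : ℝ} {A B : Set X} {x : X} (hA : x ∈ A) (hB : x ∈ nbhd R B) :
    setDist A B ≤ ENNReal.ofReal R := by
  obtain ⟨b, hb, hd⟩ := hB
  refine (iInf₂_le x hA).trans ((Metric.infEDist_le_edist_of_mem hb).trans ?_)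
  rw [edist_dist]
  exact ENNReal.ofReal_le_ofReal hd

end Projection

end CoarseGeom

/-! ### The projection theorem -/

theorem mainTheorem6 (δ K ε : ℝ) (hδ : 0 ≤ δ) (hK : 0 ≤ K) (hε : 0 ≤ ε) :
    ∃ L D R : ℝ, 0 ≤ L ∧ 0 ≤ D ∧ 0 ≤ R ∧
      ∀ (X : Type*) [MetricSpace X], CoarseGeom.IsHyperbolicSpace δ X →
        ∀ U : Set X, CoarseGeom.IsQuasiconvex K U →
          ∀ P : X → U, CoarseGeom.IsApproxProjection ε U P →
            CoarseGeom.IsCoarselyLipschitz L L P ∧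
            ∀ V : Set X, CoarseGeom.IsQuasiconvex K V →
              (∀ v₁ ∈ V, ∀ v₂ ∈ V, D ≤ dist (P v₁) (P v₂) →
                (P v₁ : X) ∈ CoarseGeom.nbhd R V ∧ (P v₂ : X) ∈ CoarseGeom.nbhd R V) ∧
              (ENNReal.ofReal D ≤ Metric.ediam (P '' V) →
                CoarseGeom.setDist U V ≤ ENNReal.ofReal R) := by
  obtain ⟨η, hη⟩ : ∃ η, η = 3 * δ + 1 := ⟨_, rfl⟩
  obtain ⟨B, hB⟩ : ∃ B, B = K + 2 + 2 * η + ε := ⟨_, rfl⟩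
  have hη0 : 0 ≤ η := by linarith
  have hB0 : 0 ≤ B := by linarith
  -- The extra 1 in `D` makes the threshold of the dichotomy strict, so a diameter that is not
  -- attained still yields a suitable pair.
  refine ⟨4 * B + 2 * η + 1, 2 * B + η + 1, (4 * B + 2 * η) + (K + 2) + 2 * η,
    by linarith, by linarith, by linarith, ?_⟩
  intro X _ hX U hU P hP
  have hG : CoarseGeom.GromovHyperbolic η X := hη ▸ hX.gromovHyperbolic hδ
  have hUc := hU.isCoarselyConvex hX
  have hPn := hP.isApproxNearestPoint hε
  have hdich : ∀ v₁ v₂ : X, dist (P v₁ : X) (P v₂) ≤ 2 * B + η ∨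
      dist v₁ (P v₁) + dist (P v₁ : X) (P v₂) + dist v₂ (P v₂) ≤
        dist v₁ v₂ + 4 * B + 2 * η := fun v₁ v₂ => by
    rw [hB]
    exact (hPn v₁).dist_le_or hG hUc (hPn v₂)
  refine ⟨fun v₁ v₂ => ?_, fun V hV => ?_⟩
  · have h0 : 0 ≤ dist v₁ v₂ := dist_nonneg
    have h1 : 0 ≤ (4 * B + 2 * η) * dist v₁ v₂ := by positivity
    have h2 : 0 ≤ dist v₁ (P v₁) := dist_nonneg
    have h3 : 0 ≤ dist v₂ (P v₂) := dist_nonneg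
    rw [Subtype.dist_eq]
    rcases hdich v₁ v₂ with h | h <;> linarith
  have hVc := hV.isCoarselyConvex hX
  have key : ∀ v₁ ∈ V, ∀ v₂ ∈ V, 2 * B + η < dist (P v₁) (P v₂) →
      (P v₁ : X) ∈ CoarseGeom.nbhd ((4 * B + 2 * η) + (K + 2) + 2 * η) V := by
    intro v₁ h₁ v₂ h₂ hd
    refine hVc.mem_nbhd (by linarith) hG h₁ h₂ ?_
    have h := (hdich v₁ v₂).resolve_left (not_le.2 hd)
    have h3 := dist_triangle (P v₁ : X) (P v₂) v₂
    rw [dist_comm (P v₂ : X) v₂] at h3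
    linarith
  refine ⟨fun v₁ h₁ v₂ h₂ hd => ⟨key v₁ h₁ v₂ h₂ (by linarith),
    key v₂ h₂ v₁ h₁ (by rw [dist_comm]; linarith)⟩, fun hd => ?_⟩
  have hlt : ENNReal.ofReal (2 * B + η) < Metric.ediam (P '' V) :=
    ((ENNReal.ofReal_lt_ofReal_iff (by linarith)).2 (by linarith)).trans_le hd
  obtain ⟨v₁, h₁, v₂, h₂, h12⟩ : ∃ v₁ ∈ V, ∃ v₂ ∈ V, 2 * B + η < dist (P v₁) (P v₂) := by
    by_contra! hcon
    refine hlt.not_ge (Metric.ediam_le ?_)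
    rintro _ ⟨v₁, h₁, rfl⟩ _ ⟨v₂, h₂, rfl⟩
    rw [edist_dist]
    exact ENNReal.ofReal_le_ofReal (hcon v₁ h₁ v₂ h₂)
  exact CoarseGeom.setDist_le_of_mem_nbhd (P v₁).2 (key v₁ h₁ v₂ h₂ h12)
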